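/- Let $d\ge 0$ be an integer, let $\Omega=\mathbb T^d=\mathbb R^d/\mathbb Z^d$, and let $\phi,\psi\in C^1(\Omega)$ satisfy $\phi<\psi$ in $\Omega$. For $\varepsilon\in(0,1)$ and $p\in\mathbb R^d$ put $|p|_\varepsilon=\sqrt{\varepsilon^2+|p|^2}$, and for $x\in\Omega$, $s\in\mathbb R$ put $$V_\varepsilon(x,s)=\tfrac1\varepsilon(\phi(x)-s)_+^4+\tfrac1\varepsilon(s-\psi(x))_+^4 .$$ Let $u_\varepsilon\in C^1(\Omega)$, $\varepsilon\in(0,1)$, and let $u\in W^{1,\infty}(\Omega)$ (with weak gradient $\nabla u\in L^\infty(\Omega;\mathbb R^d)$). Set $$\nu_\varepsilon=-\frac{\nabla u_\varepsilon}{|\nabla u_\varepsilon|_\varepsilon},\qquad H_\varepsilon=\operatorname{div}\nu_\varepsilon,\qquad f_\varepsilon(x)=-\partial_sV_\varepsilon(x,u_\varepsilon(x)),$$ where the divergence is understood in the weak sense and is assumed to be an $L^1(\Omega)$ function. Assume that (A1) $\displaystyle\sup_{\varepsilon\in(0,1),\,x\in\Omega}\{|u_\varepsilon(x)|,|\nabla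 u_\varepsilon(x)|\}<\infty$; (A2) $u_\varepsilon\to u$ uniformly in $\Omega$ as $\varepsilon\to0^+$, and $\phi\le u\le\psi$ in $\Omega$; (A3) $\nabla u_\varepsilon\rightharpoonup\nabla u$ weakly-$\ast$ in $L^\infty(\Omega;\mathbb R^d)$ as $\varepsilon\to0^+$; (A4) $\displaystyle\sup_{\varepsilon\in(0,1)}\int_\Omega|-H_\varepsilon+f_\varepsilon|\,dx<\infty$. Then $|\nabla u_\varepsilon|\rightharpoonup|\nabla u|$ weakly-$\ast$ in $L^\infty(\Omega)$ as $\varepsilon\to0^+$. -/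

import Mathlib

open Set Filter Topology MeasureTheory

noncomputable section

namespace ObstacleMCF

/-- Euclidean space `ℝ^d`. Functions on the flat torus `𝕋^d = ℝ^d / ℤ^d` are represented by
`ℤ^d`-periodic functions on `ℝ^d`. -/
abbrev E (d : ℕ) : Type := EuclideanSpace ℝ (Fin d)

/-- `ℤ^d`-periodicity, i.e. `f` is a function on the torus `𝕋^d`. -/
def IsPeriodic {d : ℕ} {α : Type*} (f : E d → α) : Prop :=
  ∀ (k : Fin d → ℤ) (x : E d), f (x + WithLp.toLp 2 (fun i => (k i : ℝ))) = f x

/-- The fundamental cell `[0,1)^d` of the torus. -/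
def cell (d : ℕ) : Set (E d) := {x | ∀ i, x i ∈ Ico (0 : ℝ) 1}

/-- Lebesgue measure on the torus: Lebesgue measure on the fundamental cell. -/
def torusMeasure (d : ℕ) : Measure (E d) := volume.restrict (cell d)

/-- `f ∈ C¹(𝕋^d)`. -/
def IsC1Torus {d : ℕ} (f : E d → ℝ) : Prop :=
  IsPeriodic f ∧ ContDiff ℝ 1 f

/-- `u ∈ W^{1,∞}(𝕋^d)` with weak gradient `G ∈ L^∞(𝕋^d; ℝ^d)`. -/
structure IsW1Infty {d : ℕ} (u : E d → ℝ) (G : E d → E d) : Prop where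
  periodic : IsPeriodic u
  memLp : MemLp u ⊤ (torusMeasure d)
  memLp_grad : MemLp G ⊤ (torusMeasure d)
  weak_grad : ∀ ζ : E d → ℝ, IsC1Torus ζ → ∀ i : Fin d,
    ∫ x, G x i * ζ x ∂(torusMeasure d) = - ∫ x, u x * gradient ζ x i ∂(torusMeasure d)

/-- `h ∈ L¹(𝕋^d)` is the weak (distributional) divergence of the vector field `X`. -/
structure HasWeakDiv {d : ℕ} (X : E d → E d) (h : E d → ℝ) : Prop where
  integrable : Integrable h (torusMeasure d)
  weak_div : ∀ ζ : E d → ℝ, IsC1Torus ζ →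
    ∫ x, h x * ζ x ∂(torusMeasure d) = - ∫ x, inner ℝ (X x) (gradient ζ x) ∂(torusMeasure d)

/-- Weak-* convergence in `L^∞(𝕋^d; F)`, the dual space of `L¹(𝕋^d; F)`. -/
structure WeakStarTendsto {d : ℕ} {ι F : Type*} [NormedAddCommGroup F] [InnerProductSpace ℝ F]
    (g : ι → E d → F) (l : Filter ι) (g₀ : E d → F) : Prop where
  eventually_memLp : ∀ᶠ i in l, MemLp (g i) ⊤ (torusMeasure d)
  memLp_limit : MemLp g₀ ⊤ (torusMeasure d)
  tendsto_pairing : ∀ η : E d → F, Integrable η (torusMeasure d) →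
    Tendsto (fun i => ∫ x, inner ℝ (g i x) (η x) ∂(torusMeasure d)) l
      (𝓝 (∫ x, inner ℝ (g₀ x) (η x) ∂(torusMeasure d)))

/-- `|p|_ε = √(ε² + |p|²)`. -/
def regNorm {d : ℕ} (ε : ℝ) (p : E d) : ℝ := Real.sqrt (ε ^ 2 + ‖p‖ ^ 2)

/-- The regularized normal `ν_ε = -∇v / |∇v|_ε`. -/
def normal {d : ℕ} (ε : ℝ) (v : E d → ℝ) (x : E d) : E d :=
  -((regNorm ε (gradient v x))⁻¹ • gradient v x)

/-- The penalization potential `V_ε(s) = (φ(x) - s)₊⁴ / ε + (s - ψ(x))₊⁴ / ε` at the point `x`. -/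
def potential {d : ℕ} (ε : ℝ) (φ ψ : E d → ℝ) (x : E d) (s : ℝ) : ℝ :=
  1 / ε * (max (φ x - s) 0) ^ 4 + 1 / ε * (max (s - ψ x) 0) ^ 4

/-- The forcing term `f_ε = -V_ε'(v)`, the derivative being taken in `s`. -/
def forcing {d : ℕ} (ε : ℝ) (φ ψ : E d → ℝ) (v : E d → ℝ) (x : E d) : ℝ :=
  - deriv (potential ε φ ψ x) (v x)

end ObstacleMCF

end

/-!
Testing the weak form of `H_ε = div ν_ε` with `w - u_ε`, where `w` is a `C¹` function between the
obstacles and uniformly close to `u`, and using that `-ν_ε` is a subgradient of `|·|_ε` at `∇u_ε`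
while the forcing points towards the obstacle interval, gives
`∫ |∇u_ε| ≤ ∫ |∇w| + ε + (∫ |-H_ε + f_ε|) sup |w - u_ε|`.
The functions `(1 - θ) u_ε + θ (φ + ψ) / 2` are admissible as `w` when `ε` is small compared with
`θ`, and their gradients converge weakly, so by Mazur's theorem `∇u` is a strong `L²` limit of
gradients of admissible functions. Hence `limsup ∫ |∇u_ε| ≤ ∫ |∇u|`, that is, the nonnegative
functions `|∇u_ε| - ∇u_ε · ∇u / |∇u|` tend to zero in `L¹`; being bounded, they also tend to zero
weakly-*, whereas `∇u_ε · ∇u / |∇u|` tends weakly-* to `|∇u|`.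
-/

namespace ObstacleMCF

section RealInequalities

lemma hasDerivAt_max_zero_pow {n : ℕ} (hn : 1 < n) (s : ℝ) :
    HasDerivAt (fun t : ℝ => max t 0 ^ n) (n * max s 0 ^ (n - 1)) s := by
  have hn₀ : n ≠ 0 := by lia
  have hn₁ : n - 1 ≠ 0 := by lia
  rcases lt_trichotomy s 0 with hs | rfl | hs
  · have h : (fun t : ℝ => max t 0 ^ n) =ᶠ[𝓝 s] fun _ => 0 := by
      filter_upwards [Iio_mem_nhds hs] with t ht
      rw [max_eq_right (mem_Iio.1 ht).le, zero_pow hn₀]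
    simpa [max_eq_right hs.le, hn₁] using (hasDerivAt_const s (0 : ℝ)).congr_of_eventuallyEq h
  · have h : HasDerivAt (fun t : ℝ => t ^ n) 0 0 := by simpa [hn₁] using hasDerivAt_pow n (0 : ℝ)
    rw [max_self, zero_pow hn₁, mul_zero]
    rw [hasDerivAt_iff_isLittleO] at h ⊢
    refine (Asymptotics.IsBigO.of_bound 1 (Eventually.of_forall fun t => ?_)).trans_isLittleO h
    rcases le_total t 0 with ht | ht <;> simp [ht, hn₀]
  · have h : (fun t : ℝ => max t 0 ^ n) =ᶠ[𝓝 s] fun t => t ^ n := by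
      filter_upwards [Ioi_mem_nhds hs] with t ht
      rw [max_eq_left (mem_Ioi.1 ht).le]
    simpa [max_eq_left hs.le] using (hasDerivAt_pow n s).congr_of_eventuallyEq h

lemma max_zero_pow_mul_nonneg {n : ℕ} (hn : n ≠ 0) {a b : ℝ} (hab : a ≤ b) :
    0 ≤ max a 0 ^ n * b := by
  rcases le_total a 0 with ha | ha
  · simp [ha, hn]
  · exact mul_nonneg (by positivity) (ha.trans hab)

lemma one_sub_mul_add_mul_mem_Icc {a b c u v m θ : ℝ} (hu : u ∈ Icc a b)
    (hc : c ∈ Icc (a + m) (b - m)) (hθ : θ ∈ Icc (0 : ℝ) 1) (hv : |v - u| ≤ θ * m) :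
    (1 - θ) * v + θ * c ∈ Icc a b := by
  have hθ' : 0 ≤ 1 - θ := sub_nonneg.2 hθ.2
  have hm : 0 ≤ θ * (θ * m) := mul_nonneg hθ.1 ((abs_nonneg _).trans hv)
  obtain ⟨hlo, hhi⟩ := abs_le.1 hv
  constructor
  · nlinarith [mul_le_mul_of_nonneg_left (show a - θ * m ≤ v by linarith [hu.1]) hθ',
      mul_le_mul_of_nonneg_left hc.1 hθ.1]
  · nlinarith [mul_le_mul_of_nonneg_left (show v ≤ b + θ * m by linarith [hu.2]) hθ',
      mul_le_mul_of_nonneg_left hc.2 hθ.1]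

lemma abs_one_sub_mul_add_mul_sub_le {c u v θ : ℝ} (hθ : θ ∈ Icc (0 : ℝ) 1) :
    |(1 - θ) * v + θ * c - u| ≤ |v - u| + θ * |c - u| :=
  calc |(1 - θ) * v + θ * c - u| = |(1 - θ) * (v - u) + θ * (c - u)| := by ring_nf
    _ ≤ (1 - θ) * |v - u| + θ * |c - u| := by
      refine (abs_add_le _ _).trans_eq ?_
      rw [abs_mul, abs_mul, abs_of_nonneg (sub_nonneg.2 hθ.2), abs_of_nonneg hθ.1]
    _ ≤ |v - u| + θ * |c - u| := by
      gcongr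
      exact mul_le_of_le_one_left (abs_nonneg _) (by linarith [hθ.1])

end RealInequalities

section FunctionalAnalysis

/-- A form of Mazur's theorem. -/
lemma mem_closure_of_forall_dual_mem_closure_image {X : Type*} [TopologicalSpace X]
    [AddCommGroup X] [Module ℝ X] [IsTopologicalAddGroup X] [ContinuousSMul ℝ X]
    [LocallyConvexSpace ℝ X] {S : Set X} (hS : Convex ℝ S) {x : X}
    (h : ∀ f : StrongDual ℝ X, f x ∈ closure (f '' S)) : x ∈ closure S := by
  by_contra hx
  obtain ⟨f, a, hfS, hfx⟩ := geometric_hahn_banach_closed_point hS.closure isClosed_closure hx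
  have himage : f '' S ⊆ Iic a := image_subset_iff.2 fun s hs => (hfS s (subset_closure hs)).le
  exact hfx.not_ge (closure_minimal himage isClosed_Iic (h f))

variable {α ι : Type*} [MeasurableSpace α] {μ : Measure α} {l : Filter ι}

lemma continuous_integral_norm_Lp {F : Type*} [NormedAddCommGroup F] [IsFiniteMeasure μ]
    {p : ENNReal} [hp : Fact (1 ≤ p)] : Continuous fun f : Lp F p μ => ∫ x, ‖f x‖ ∂μ := by
  refine continuous_iff_continuousAt.2 fun f => ?_
  have hLp : Tendsto (fun g : Lp F p μ => eLpNorm (⇑g - ⇑f) p μ) (𝓝 f) (𝓝 0) :=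
    (Lp.tendsto_Lp_iff_tendsto_eLpNorm' _ _).1 tendsto_id
  have hL1 : Tendsto (fun g : Lp F p μ => eLpNorm (⇑g - ⇑f) 1 μ) (𝓝 f) (𝓝 0) := by
    have hexp : 0 ≤ 1 / (1 : ENNReal).toReal - 1 / p.toReal := by
      simpa using ENNReal.toReal_mono ENNReal.one_ne_top (ENNReal.inv_le_one.2 hp.out)
    have hscaled := ENNReal.Tendsto.mul_const
      (b := μ univ ^ (1 / (1 : ENNReal).toReal - 1 / p.toReal)) hLp
      (Or.inr (ENNReal.rpow_ne_top_of_nonneg hexp (measure_ne_top μ univ)))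
    rw [zero_mul] at hscaled
    exact tendsto_of_tendsto_of_tendsto_of_le_of_le tendsto_const_nhds hscaled (fun _ => zero_le)
      fun g => eLpNorm_le_eLpNorm_mul_rpow_measure_univ hp.out
        ((Lp.aestronglyMeasurable g).sub (Lp.aestronglyMeasurable f))
  have hint : ∀ g : Lp F p μ, Integrable (fun x => ‖g x‖) μ :=
    fun g => ((Lp.memLp g).integrable hp.out).norm
  refine tendsto_integral_of_L1' _ (hint f).1 (Eventually.of_forall hint) ?_
  refine tendsto_of_tendsto_of_tendsto_of_le_of_le tendsto_const_nhds hL1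
    (fun _ => zero_le) fun g => eLpNorm_mono fun x => ?_
  simpa using abs_norm_sub_norm_le (g x) (f x)

lemma norm_max_abs_sub_le {y t : ℝ} (ht : 0 ≤ t) : ‖max (|y| - t) 0‖ ≤ |y| := by
  rw [Real.norm_of_nonneg (le_max_right _ _)]
  exact max_le (sub_le_self _ ht) (abs_nonneg _)

lemma integrable_max_abs_sub {η : α → ℝ} (hη : Integrable η μ) {t : ℝ} (ht : 0 ≤ t) :
    Integrable (fun x => max (|η x| - t) 0) μ :=
  hη.abs.mono' ((hη.1.norm.sub aestronglyMeasurable_const).sup aestronglyMeasurable_const)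
    (Eventually.of_forall fun _ => norm_max_abs_sub_le ht)

lemma tendsto_integral_max_abs_sub_atTop {η : α → ℝ} (hη : Integrable η μ) :
    Tendsto (fun t : ℝ => ∫ x, max (|η x| - t) 0 ∂μ) atTop (𝓝 0) := by
  suffices h : Tendsto (fun t : ℝ => ∫ x, max (|η x| - t) 0 ∂μ) atTop (𝓝 (∫ _, 0 ∂μ)) by
    rwa [integral_zero] at h
  refine tendsto_integral_filter_of_dominated_convergence (fun x => |η x|) ?_ ?_ hη.abs
    (Eventually.of_forall fun x => tendsto_const_nhds.congr' ?_)
  · filter_upwards [eventually_ge_atTop 0] with t ht using (integrable_max_abs_sub hη ht).1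
  · filter_upwards [eventually_ge_atTop 0] with t ht
    exact Eventually.of_forall fun _ => norm_max_abs_sub_le ht
  · filter_upwards [eventually_ge_atTop |η x|] with t ht
    rw [max_eq_right (sub_nonpos.2 ht)]

lemma abs_integral_mul_le_of_nonneg_of_le {a η : α → ℝ} {C t : ℝ} (ha : Integrable a μ)
    (ha₀ : ∀ᵐ x ∂μ, 0 ≤ a x) (haC : ∀ᵐ x ∂μ, a x ≤ C) (hη : Integrable η μ) (ht : 0 ≤ t) :
    |∫ x, a x * η x ∂μ| ≤ t * ∫ x, a x ∂μ + C * ∫ x, max (|η x| - t) 0 ∂μ := by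
  have htail := (integrable_max_abs_sub hη ht).const_mul C
  rw [← integral_const_mul, ← integral_const_mul, ← integral_add (ha.const_mul _) htail,
    ← Real.norm_eq_abs]
  refine norm_integral_le_of_norm_le ((ha.const_mul _).add htail) ?_
  filter_upwards [ha₀, haC] with x h₀ hC
  calc ‖a x * η x‖ = a x * |η x| := by rw [norm_mul, Real.norm_of_nonneg h₀, Real.norm_eq_abs]
    _ ≤ a x * (t + max (|η x| - t) 0) := by gcongr; linarith [le_max_left (|η x| - t) 0]
    _ = t * a x + a x * max (|η x| - t) 0 := by ring
    _ ≤ t * a x + C * max (|η x| - t) 0 := by gcongr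

lemma tendsto_integral_mul_of_tendsto_integral {a : ι → α → ℝ} {C : ℝ}
    (ha : ∀ᶠ i in l, Integrable (a i) μ) (ha₀ : ∀ᶠ i in l, ∀ᵐ x ∂μ, 0 ≤ a i x)
    (haC : ∀ᶠ i in l, ∀ᵐ x ∂μ, a i x ≤ C) (hlim : Tendsto (fun i => ∫ x, a i x ∂μ) l (𝓝 0))
    {η : α → ℝ} (hη : Integrable η μ) : Tendsto (fun i => ∫ x, a i x * η x ∂μ) l (𝓝 0) := by
  rw [Metric.tendsto_nhds]
  intro δ hδ
  have htail := (tendsto_integral_max_abs_sub_atTop hη).const_mul C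
  rw [mul_zero] at htail
  obtain ⟨t, ht, htδ⟩ :=
    ((eventually_ge_atTop 0).and (htail.eventually_lt_const (half_pos hδ))).exists
  have hbulk := hlim.const_mul t
  rw [mul_zero] at hbulk
  filter_upwards [ha, ha₀, haC, hbulk.eventually_lt_const (half_pos hδ)] with i h h₀ hC hi
  rw [dist_zero_right, Real.norm_eq_abs]
  linarith [abs_integral_mul_le_of_nonneg_of_le h h₀ hC hη ht]

end FunctionalAnalysis

section DirectionDefect

open NormedSpace (normalize)

variable {F : Type*} [NormedAddCommGroup F] [InnerProductSpace ℝ F]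

lemma norm_normalize_le_one (q : F) : ‖normalize q‖ ≤ 1 := by
  rcases eq_or_ne q 0 with rfl | hq
  · simp
  · exact (NormedSpace.norm_normalize_eq_one_iff.2 hq).le

lemma inner_normalize_self (q : F) : inner ℝ q (normalize q) = ‖q‖ := by
  rw [NormedSpace.normalize, real_inner_smul_right, real_inner_self_eq_norm_sq, pow_two,
    ← mul_assoc, inv_mul_mul_self]

lemma abs_inner_normalize_le_norm (p q : F) : |inner ℝ p (normalize q)| ≤ ‖p‖ :=
  (abs_real_inner_le_norm _ _).trans
    (mul_le_of_le_one_right (norm_nonneg _) (norm_normalize_le_one q))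

/-- The amount by which the length of `p` exceeds its component in the direction of `q`. Integrated
over `x`, it measures the failure of the vectors `p x` to align with `q x`. -/
noncomputable def directionDefect (q p : F) : ℝ := ‖p‖ - inner ℝ p (normalize q)

lemma directionDefect_nonneg (q p : F) : 0 ≤ directionDefect q p :=
  sub_nonneg.2 ((le_abs_self _).trans (abs_inner_normalize_le_norm p q))

lemma directionDefect_le (q p : F) : directionDefect q p ≤ 2 * ‖p‖ := by
  rw [directionDefect]
  linarith [neg_le_of_abs_le (abs_inner_normalize_le_norm p q)]

section Measure

variable {α : Type*} [MeasurableSpace α] {μ : Measure α} {g q : α → F}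

lemma aestronglyMeasurable_normalize (hq : AEStronglyMeasurable q μ) :
    AEStronglyMeasurable (fun x => normalize (q x)) μ :=
  hq.norm.aemeasurable.inv.aestronglyMeasurable.smul hq

lemma integrable_smul_normalize {η : α → ℝ} (hη : Integrable η μ)
    (hq : AEStronglyMeasurable q μ) : Integrable (fun x => η x • normalize (q x)) μ :=
  hη.smul_bdd 1 (aestronglyMeasurable_normalize hq)
    (Eventually.of_forall fun x => norm_normalize_le_one (q x))

lemma integrable_inner_normalize (hg : Integrable g μ) (hq : AEStronglyMeasurable q μ) :
    Integrable (fun x => inner ℝ (g x) (normalize (q x))) μ :=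
  hg.norm.mono' (hg.1.inner (aestronglyMeasurable_normalize hq))
    (Eventually.of_forall fun x => abs_inner_normalize_le_norm (g x) (q x))

lemma integrable_directionDefect (hg : Integrable g μ) (hq : AEStronglyMeasurable q μ) :
    Integrable (fun x => directionDefect (q x) (g x)) μ :=
  hg.norm.sub (integrable_inner_normalize hg hq)

end Measure

end DirectionDefect

section Cell

variable {d : ℕ}

lemma measurableSet_cell : MeasurableSet (cell d) := by
  rw [cell, ofPred_forall]
  exact MeasurableSet.iInter fun i =>
    (EuclideanSpace.proj (𝕜 := ℝ) i).continuous.measurable measurableSet_Ico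

lemma isBounded_cell : Bornology.IsBounded (cell d) :=
  ((EuclideanSpace.equiv (Fin d) ℝ).toHomeomorph.isCompact_preimage.2
    isCompact_Icc).isBounded.subset fun _ hx =>
      (⟨fun i => (hx i).1, fun i => (hx i).2.le⟩ : _ ∈ Icc (0 : Fin d → ℝ) 1)

instance : IsFiniteMeasure (torusMeasure d) :=
  ⟨by simpa [torusMeasure] using isBounded_cell.measure_lt_top⟩

lemma ae_torusMeasure_of_forall_mem_cell {P : E d → Prop} (h : ∀ x ∈ cell d, P x) :
    ∀ᵐ x ∂(torusMeasure d), P x :=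
  (ae_restrict_mem measurableSet_cell).mono h

lemma exists_norm_le_on_cell {F : Type*} [SeminormedAddCommGroup F] {g : E d → F}
    (hg : Continuous g) : ∃ C, ∀ x ∈ cell d, ‖g x‖ ≤ C :=
  (isBounded_cell.isCompact_closure.exists_bound_of_continuousOn hg.continuousOn).imp
    fun _ hC x hx => hC x (subset_closure hx)

lemma exists_pos_le_on_cell {g : E d → ℝ} (hg : Continuous g) (hpos : ∀ x, 0 < g x) :
    ∃ m, 0 < m ∧ ∀ x ∈ cell d, m ≤ g x :=
  (isBounded_cell.isCompact_closure.exists_forall_le' hg.continuousOn fun x _ => hpos x).imp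
    fun _ hm => ⟨hm.1, fun x hx => hm.2 x (subset_closure hx)⟩

variable {F : Type*} [NormedAddCommGroup F] {g : E d → F}

lemma memLp_of_continuous (hg : Continuous g) (p : ENNReal) : MemLp g p (torusMeasure d) := by
  obtain ⟨C, hC⟩ := exists_norm_le_on_cell hg
  exact MemLp.of_bound hg.aestronglyMeasurable C (ae_torusMeasure_of_forall_mem_cell hC)

lemma integrable_of_continuous (hg : Continuous g) : Integrable g (torusMeasure d) :=
  memLp_one_iff_integrable.1 (memLp_of_continuous hg 1)

end Cell

section WeakStar

variable {d : ℕ} {ι F : Type*} [NormedAddCommGroup F] [InnerProductSpace ℝ F] {l : Filter ι}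
  {g : ι → E d → F} {g₀ : E d → F}

lemma WeakStarTendsto.tendsto_integral_mul_inner_normalize (hg : WeakStarTendsto g l g₀)
    {η : E d → ℝ} (hη : Integrable η (torusMeasure d)) :
    Tendsto (fun i => ∫ x, η x * inner ℝ (g i x) (NormedSpace.normalize (g₀ x)) ∂(torusMeasure d))
      l (𝓝 (∫ x, η x * ‖g₀ x‖ ∂(torusMeasure d))) := by
  simpa only [real_inner_smul_right, inner_normalize_self] using
    hg.tendsto_pairing _ (integrable_smul_normalize hη hg.memLp_limit.1)

lemma WeakStarTendsto.tendsto_integral_directionDefect (hg : WeakStarTendsto g l g₀)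
    (hle : ∀ δ > 0, ∀ᶠ i in l, ∫ x, ‖g i x‖ ∂(torusMeasure d) ≤
      ∫ x, ‖g₀ x‖ ∂(torusMeasure d) + δ) :
    Tendsto (fun i => ∫ x, directionDefect (g₀ x) (g i x) ∂(torusMeasure d)) l (𝓝 0) := by
  have hinner : Tendsto
      (fun i => ∫ x, inner ℝ (g i x) (NormedSpace.normalize (g₀ x)) ∂(torusMeasure d)) l
      (𝓝 (∫ x, ‖g₀ x‖ ∂(torusMeasure d))) := by
    simpa only [one_mul] using hg.tendsto_integral_mul_inner_normalize (integrable_const 1)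
  rw [Metric.tendsto_nhds]
  intro δ hδ
  filter_upwards [hg.eventually_memLp, hle (δ / 2) (half_pos hδ),
    hinner.eventually_const_lt (sub_lt_self _ (half_pos hδ))] with i hi hnorm hdir
  have hgi : Integrable (g i) (torusMeasure d) := hi.integrable le_top
  rw [dist_zero_right, Real.norm_of_nonneg (integral_nonneg fun x => directionDefect_nonneg _ _)]
  simp only [directionDefect]
  rw [integral_sub hgi.norm (integrable_inner_normalize hgi hg.memLp_limit.1)]
  linarith

/-- The bound on `limsup ∫ ‖g i‖` rules out oscillations, the only obstruction to passing to the
limit in the norm. -/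
theorem WeakStarTendsto.norm_of_integral_norm_le {C : ℝ} (hg : WeakStarTendsto g l g₀)
    (hC : ∀ᶠ i in l, ∀ᵐ x ∂(torusMeasure d), ‖g i x‖ ≤ C)
    (hle : ∀ δ > 0, ∀ᶠ i in l, ∫ x, ‖g i x‖ ∂(torusMeasure d) ≤
      ∫ x, ‖g₀ x‖ ∂(torusMeasure d) + δ) :
    WeakStarTendsto (fun i x => ‖g i x‖) l (fun x => ‖g₀ x‖) := by
  refine ⟨hg.eventually_memLp.mono fun i hi => hi.norm, hg.memLp_limit.norm, fun η hη => ?_⟩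
  have hdefect_int : ∀ᶠ i in l,
      Integrable (fun x => directionDefect (g₀ x) (g i x)) (torusMeasure d) :=
    hg.eventually_memLp.mono fun i hi =>
      integrable_directionDefect (hi.integrable le_top) hg.memLp_limit.1
  have hdefect_le : ∀ᶠ i in l, ∀ᵐ x ∂(torusMeasure d), directionDefect (g₀ x) (g i x) ≤ 2 * C :=
    hC.mono fun i hi => hi.mono fun x hx => (directionDefect_le _ _).trans (by gcongr)
  have hdefect := tendsto_integral_mul_of_tendsto_integral hdefect_int
    (Eventually.of_forall fun i => Eventually.of_forall fun x => directionDefect_nonneg _ _)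
    hdefect_le (hg.tendsto_integral_directionDefect hle) hη
  have hsum := hdefect.add (hg.tendsto_integral_mul_inner_normalize hη)
  rw [zero_add] at hsum
  simp only [RCLike.inner_apply, conj_trivial]
  refine hsum.congr' ?_
  filter_upwards [hg.eventually_memLp, hC, hdefect_int, hdefect_le] with i hi hCi hint hle'
  have hgi : Integrable (g i) (torusMeasure d) := hi.integrable le_top
  rw [← integral_add]
  · refine integral_congr_ae (Eventually.of_forall fun x => ?_)
    simp only [directionDefect]
    ring
  · refine hη.bdd_mul (c := 2 * C) hint.1 (hle'.mono fun x hx => ?_)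
    rwa [Real.norm_of_nonneg (directionDefect_nonneg _ _)]
  · exact hη.mul_bdd (integrable_inner_normalize hgi hg.memLp_limit.1).1
      (hCi.mono fun x hx => (abs_inner_normalize_le_norm _ _).trans hx)

end WeakStar

section Gradient

variable {X : Type*} [NormedAddCommGroup X] [InnerProductSpace ℝ X] [CompleteSpace X]
  {f g : X → ℝ} {x : X}

lemma gradient_add (hf : DifferentiableAt ℝ f x) (hg : DifferentiableAt ℝ g x) :
    gradient (f + g) x = gradient f x + gradient g x := by
  rw [gradient, fderiv_add hf hg, map_add, gradient, gradient]

lemma gradient_sub (hf : DifferentiableAt ℝ f x) (hg : DifferentiableAt ℝ g x) :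
    gradient (f - g) x = gradient f x - gradient g x := by
  rw [gradient, fderiv_sub hf hg, map_sub, gradient, gradient]

lemma gradient_const_smul (hf : DifferentiableAt ℝ f x) (c : ℝ) :
    gradient (c • f) x = c • gradient f x := by
  rw [gradient, fderiv_const_smul hf, map_smulₛₗ, conj_trivial, gradient]

lemma continuous_gradient (hf : ContDiff ℝ 1 f) : Continuous (gradient f) :=
  (InnerProductSpace.toDual ℝ X).symm.continuous.comp (hf.continuous_fderiv one_ne_zero)

end Gradient

section C1Torus

variable {d : ℕ} {v : E d → ℝ}

lemma IsC1Torus.continuous (hv : IsC1Torus v) : Continuous v := hv.2.continuous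

lemma IsC1Torus.differentiable (hv : IsC1Torus v) : Differentiable ℝ v :=
  hv.2.differentiable one_ne_zero

lemma IsC1Torus.continuous_gradient (hv : IsC1Torus v) : Continuous (gradient v) :=
  ObstacleMCF.continuous_gradient hv.2

/-- `C¹(𝕋^d)` as a vector space, so that the gradient becomes a linear map into `L²`. -/
def c1Torus (d : ℕ) : Submodule ℝ (E d → ℝ) where
  carrier := {v | IsC1Torus v}
  add_mem' hv hw := ⟨fun k x => congrArg₂ (· + ·) (hv.1 k x) (hw.1 k x), hv.2.add hw.2⟩
  zero_mem' := ⟨fun _ _ => rfl, contDiff_const⟩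
  smul_mem' c _ hv := ⟨fun k x => congrArg (c • ·) (hv.1 k x), hv.2.const_smul c⟩

lemma memLp_gradient (v : c1Torus d) : MemLp (gradient (v : E d → ℝ)) 2 (torusMeasure d) :=
  memLp_of_continuous (IsC1Torus.continuous_gradient v.2) 2

lemma gradient_coe_add (v w : c1Torus d) : gradient ((v + w : c1Torus d) : E d → ℝ) =
    gradient (v : E d → ℝ) + gradient (w : E d → ℝ) :=
  funext fun x => gradient_add (IsC1Torus.differentiable v.2 x) (IsC1Torus.differentiable w.2 x)

lemma gradient_coe_smul (c : ℝ) (v : c1Torus d) :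
    gradient ((c • v : c1Torus d) : E d → ℝ) = c • gradient (v : E d → ℝ) :=
  funext fun x => gradient_const_smul (IsC1Torus.differentiable v.2 x) c

/-- The gradient `C¹(𝕋^d) → L²(𝕋^d; ℝ^d)`. The target is a Hilbert space, which identifies the
functionals in the Hahn–Banach argument. -/
noncomputable def gradientL2 (d : ℕ) : c1Torus d →ₗ[ℝ] Lp (E d) 2 (torusMeasure d) where
  toFun v := (memLp_gradient v).toLp (gradient (v : E d → ℝ))
  map_add' v w := by
    rw [← MemLp.toLp_add (memLp_gradient v) (memLp_gradient w)]
    exact MemLp.toLp_congr _ _ (Eventually.of_forall (congrFun (gradient_coe_add v w)))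
  map_smul' c v := by
    rw [RingHom.id_apply, ← MemLp.toLp_const_smul c (memLp_gradient v)]
    exact MemLp.toLp_congr _ _ (Eventually.of_forall (congrFun (gradient_coe_smul c v)))

lemma coeFn_gradientL2 (v : c1Torus d) :
    gradientL2 d v =ᵐ[torusMeasure d] gradient (v : E d → ℝ) :=
  (memLp_gradient v).coeFn_toLp

lemma inner_toLp_eq_integral {G : E d → E d} (y : Lp (E d) 2 (torusMeasure d))
    (hG : MemLp G 2 (torusMeasure d)) :
    inner ℝ y (hG.toLp G) = ∫ x, inner ℝ (G x) (y x) ∂(torusMeasure d) := by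
  rw [L2.inner_def]
  refine integral_congr_ae (hG.coeFn_toLp.mono fun x hx => ?_)
  simp only [hx, real_inner_comm]

end C1Torus

section RegNorm

variable {d : ℕ} {ε : ℝ}

lemma regNorm_nonneg (ε : ℝ) (p : E d) : 0 ≤ regNorm ε p := Real.sqrt_nonneg _

lemma sq_regNorm (ε : ℝ) (p : E d) : regNorm ε p ^ 2 = ε ^ 2 + ‖p‖ ^ 2 :=
  Real.sq_sqrt (by positivity)

lemma regNorm_pos (hε : ε ≠ 0) (p : E d) : 0 < regNorm ε p :=
  Real.sqrt_pos.2 (by positivity)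

lemma continuous_regNorm (ε : ℝ) : Continuous (regNorm (d := d) ε) := by
  unfold regNorm
  fun_prop

lemma norm_le_regNorm (ε : ℝ) (p : E d) : ‖p‖ ≤ regNorm ε p :=
  Real.le_sqrt_of_sq_le (le_add_of_nonneg_left (sq_nonneg ε))

lemma regNorm_le_norm_add (hε : 0 ≤ ε) (p : E d) : regNorm ε p ≤ ‖p‖ + ε :=
  Real.sqrt_le_iff.2 ⟨by positivity, by nlinarith [mul_nonneg hε (norm_nonneg p)]⟩

/-- The Cauchy–Schwarz inequality for `(ε, p)` and `(ε, q)`. -/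
lemma sq_add_inner_le_regNorm_mul_regNorm (ε : ℝ) (p q : E d) :
    ε ^ 2 + inner ℝ p q ≤ regNorm ε p * regNorm ε q := by
  have hsq : (ε ^ 2 + ‖p‖ * ‖q‖) ^ 2 ≤ (regNorm ε p * regNorm ε q) ^ 2 := by
    rw [mul_pow, sq_regNorm, sq_regNorm]
    nlinarith [sq_nonneg (ε * (‖p‖ - ‖q‖))]
  calc ε ^ 2 + inner ℝ p q ≤ ε ^ 2 + ‖p‖ * ‖q‖ := by gcongr; exact real_inner_le_norm p q
    _ ≤ regNorm ε p * regNorm ε q :=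
      le_of_sq_le_sq hsq (mul_nonneg (regNorm_nonneg ε p) (regNorm_nonneg ε q))

lemma regNorm_add_inner_le (ε : ℝ) (p q : E d) :
    regNorm ε p + inner ℝ ((regNorm ε p)⁻¹ • p) (q - p) ≤ regNorm ε q := by
  rcases (regNorm_nonneg ε p).eq_or_lt with hp | hp
  · simpa [← hp] using regNorm_nonneg ε q
  · have hscaled : regNorm ε p * (regNorm ε p + inner ℝ ((regNorm ε p)⁻¹ • p) (q - p)) =
        ε ^ 2 + inner ℝ p q := by
      rw [mul_add, ← pow_two, sq_regNorm, real_inner_smul_left, mul_inv_cancel_left₀ hp.ne',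
        inner_sub_right, real_inner_self_eq_norm_sq]
      ring
    refine le_of_mul_le_mul_left ?_ hp
    rw [hscaled]
    exact sq_add_inner_le_regNorm_mul_regNorm ε p q

lemma norm_gradient_le_add_inner_normal (hε : 0 ≤ ε) (v w : E d → ℝ) (x : E d) :
    ‖gradient v x‖ ≤
      ‖gradient w x‖ + ε + inner ℝ (normal ε v x) (gradient w x - gradient v x) := by
  rw [normal, inner_neg_left]
  linarith [norm_le_regNorm ε (gradient v x), regNorm_le_norm_add hε (gradient w x),
    regNorm_add_inner_le ε (gradient v x) (gradient w x)]

lemma IsC1Torus.continuous_normal {v : E d → ℝ} (hv : IsC1Torus v) (hε : ε ≠ 0) :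
    Continuous (normal ε v) :=
  have h := hv.continuous_gradient
  ((((continuous_regNorm ε).comp h).inv₀ fun _ => (regNorm_pos hε _).ne').smul h).neg

end RegNorm

section Forcing

variable {d : ℕ}

/-- `f` is an integrable force which, at each point, pushes `v` towards the interval `[φ, ψ]`. This
is all that the argument uses about the derivative of the penalization potential. -/
structure IsRestoringForce (φ ψ v f : E d → ℝ) : Prop where
  integrable : Integrable f (torusMeasure d)
  mul_sub_nonneg : ∀ x ∈ cell d, ∀ s ∈ Icc (φ x) (ψ x), 0 ≤ f x * (s - v x)

lemma forcing_eq (ε : ℝ) (φ ψ v : E d → ℝ) (x : E d) :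
    forcing ε φ ψ v x = 4 / ε * (max (φ x - v x) 0 ^ 3 - max (v x - ψ x) 0 ^ 3) := by
  have hlower := ((hasDerivAt_max_zero_pow (n := 4) (by simp) (φ x - v x)).comp (v x)
    ((hasDerivAt_id (v x)).const_sub (φ x))).const_mul (1 / ε)
  have hupper := ((hasDerivAt_max_zero_pow (n := 4) (by simp) (v x - ψ x)).comp (v x)
    ((hasDerivAt_id (v x)).sub_const (ψ x))).const_mul (1 / ε)
  have hpotential : HasDerivAt (potential ε φ ψ x) _ (v x) := hlower.add hupper
  rw [forcing, hpotential.deriv]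
  push_cast
  ring

lemma forcing_mul_sub_nonneg {ε : ℝ} (hε : 0 ≤ ε) {φ ψ v : E d → ℝ} {x : E d} {s : ℝ}
    (hs : s ∈ Icc (φ x) (ψ x)) : 0 ≤ forcing ε φ ψ v x * (s - v x) := by
  have hlower : 0 ≤ max (φ x - v x) 0 ^ 3 * (s - v x) :=
    max_zero_pow_mul_nonneg three_ne_zero (sub_le_sub_right hs.1 _)
  have hupper : 0 ≤ max (v x - ψ x) 0 ^ 3 * (v x - s) :=
    max_zero_pow_mul_nonneg three_ne_zero (sub_le_sub_left hs.2 _)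
  calc 0 ≤ 4 / ε * (max (φ x - v x) 0 ^ 3 * (s - v x) + max (v x - ψ x) 0 ^ 3 * (v x - s)) := by
        positivity
    _ = forcing ε φ ψ v x * (s - v x) := by rw [forcing_eq]; ring

lemma continuous_forcing (ε : ℝ) {φ ψ v : E d → ℝ} (hφ : Continuous φ) (hψ : Continuous ψ)
    (hv : Continuous v) : Continuous (forcing ε φ ψ v) := by
  rw [funext (forcing_eq ε φ ψ v)]
  fun_prop

lemma isRestoringForce_forcing {ε : ℝ} (hε : 0 ≤ ε) {φ ψ v : E d → ℝ} (hφ : Continuous φ)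
    (hψ : Continuous ψ) (hv : Continuous v) : IsRestoringForce φ ψ v (forcing ε φ ψ v) :=
  ⟨integrable_of_continuous (continuous_forcing ε hφ hψ hv),
    fun _ _ _ hs => forcing_mul_sub_nonneg hε hs⟩

end Forcing

section Comparison

variable {d : ℕ} {f h : E d → ℝ} {r : ℝ}

lemma HasWeakDiv.integral_inner_gradient_le {X : E d → E d} {ζ : E d → ℝ}
    (hX : HasWeakDiv X h) (hζ : IsC1Torus ζ) (hf : Integrable f (torusMeasure d))
    (hfζ : ∀ x ∈ cell d, 0 ≤ f x * ζ x) (hζr : ∀ x ∈ cell d, |ζ x| ≤ r) :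
    ∫ x, inner ℝ (X x) (gradient ζ x) ∂(torusMeasure d) ≤
      (∫ x, |-(h x) + f x| ∂(torusMeasure d)) * r := by
  have hhζ : Integrable (fun x => h x * ζ x) (torusMeasure d) :=
    hX.integrable.mul_bdd hζ.continuous.aestronglyMeasurable
      (ae_torusMeasure_of_forall_mem_cell hζr)
  rw [← neg_eq_iff_eq_neg.2 (hX.weak_div ζ hζ), ← integral_neg, ← integral_mul_const]
  refine integral_mono_ae hhζ.neg ((hX.integrable.neg.add hf).abs.mul_const r)
    (ae_torusMeasure_of_forall_mem_cell fun x hx => ?_)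
  calc -(h x * ζ x) ≤ (-(h x) + f x) * ζ x := by linarith [hfζ x hx]
    _ ≤ |-(h x) + f x| * |ζ x| := (le_abs_self _).trans_eq (abs_mul _ _)
    _ ≤ |-(h x) + f x| * r := by gcongr; exact hζr x hx

lemma integral_norm_gradient_le {φ ψ v w : E d → ℝ} {ε : ℝ} (hε : 0 < ε) (hv : IsC1Torus v)
    (hw : IsC1Torus w) (hh : HasWeakDiv (normal ε v) h) (hf : IsRestoringForce φ ψ v f)
    (hwφψ : ∀ x ∈ cell d, w x ∈ Icc (φ x) (ψ x)) (hwv : ∀ x ∈ cell d, |w x - v x| ≤ r) :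
    ∫ x, ‖gradient v x‖ ∂(torusMeasure d) ≤
      ∫ x, ‖gradient w x‖ ∂(torusMeasure d) + ε * (torusMeasure d).real univ +
        (∫ x, |-(h x) + f x| ∂(torusMeasure d)) * r := by
  have hζ : IsC1Torus (w - v) := (c1Torus d).sub_mem hw hv
  have hgrad : ∀ x, gradient (w - v) x = gradient w x - gradient v x := fun x =>
    gradient_sub (hw.differentiable x) (hv.differentiable x)
  have hgw := integrable_of_continuous hw.continuous_gradient.norm
  have hgwε : Integrable (fun x => ‖gradient w x‖ + ε) (torusMeasure d) :=
    hgw.add (integrable_const ε)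
  have hinner : Integrable (fun x => inner ℝ (normal ε v x) (gradient (w - v) x))
      (torusMeasure d) :=
    integrable_of_continuous ((hv.continuous_normal hε.ne').inner hζ.continuous_gradient)
  calc ∫ x, ‖gradient v x‖ ∂(torusMeasure d)
      ≤ ∫ x, (‖gradient w x‖ + ε + inner ℝ (normal ε v x) (gradient (w - v) x))
          ∂(torusMeasure d) :=
        integral_mono (integrable_of_continuous hv.continuous_gradient.norm) (hgwε.add hinner)
          fun x => by
            simpa only [hgrad] using norm_gradient_le_add_inner_normal hε.le v w x
    _ = ∫ x, ‖gradient w x‖ ∂(torusMeasure d) + ε * (torusMeasure d).real univ +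
          ∫ x, inner ℝ (normal ε v x) (gradient (w - v) x) ∂(torusMeasure d) := by
        rw [integral_add hgwε hinner, integral_add hgw (integrable_const ε), integral_const,
          smul_eq_mul, mul_comm ε]
    _ ≤ _ := by
        gcongr
        exact hh.integral_inner_gradient_le hζ hf.integrable
          (fun x hx => hf.mul_sub_nonneg x hx _ (hwφψ x hx)) hwv

end Comparison

section Competitors

variable {d : ℕ}

/-- The admissible competitors: `C¹` functions between the obstacles and within `r` of `u`. -/
def competitors (φ ψ u : E d → ℝ) (r : ℝ) : Set (c1Torus d) :=
  {w | ∀ x ∈ cell d, (w : E d → ℝ) x ∈ Icc (φ x) (ψ x) ∩ Metric.closedBall (u x) r}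

lemma convex_competitors (φ ψ u : E d → ℝ) (r : ℝ) : Convex ℝ (competitors φ ψ u r) :=
  fun _ hw₁ _ hw₂ _ _ ha hb hab x hx =>
    ((convex_Icc _ _).inter (convex_closedBall _ _)) (hw₁ x hx) (hw₂ x hx) ha hb hab

lemma exists_c1Torus_mem_Icc_of_lt {φ ψ : E d → ℝ} (hφ : IsC1Torus φ) (hψ : IsC1Torus ψ)
    (hφψ : ∀ x, φ x < ψ x) : ∃ χ : c1Torus d, ∃ m > 0, ∀ x ∈ cell d,
      (χ : E d → ℝ) x ∈ Icc (φ x + m) (ψ x - m) := by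
  obtain ⟨m, hm, hgap⟩ := exists_pos_le_on_cell (hψ.continuous.sub hφ.continuous)
    fun x => sub_pos.2 (hφψ x)
  refine ⟨(1 / 2 : ℝ) • (⟨φ, hφ⟩ + ⟨ψ, hψ⟩), m / 2, half_pos hm, fun x hx => ?_⟩
  have hx' : m ≤ ψ x - φ x := hgap x hx
  change 1 / 2 * (φ x + ψ x) ∈ _
  constructor <;> linarith

variable {ι : Type*} {l : Filter ι} {φ ψ u : E d → ℝ} {χ : c1Torus d} {v : ι → E d → ℝ}
  {G : E d → E d} {m M r θ : ℝ}

lemma one_sub_smul_add_smul_mem_competitors {v : c1Torus d}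
    (hu : ∀ x ∈ cell d, u x ∈ Icc (φ x) (ψ x))
    (hχ : ∀ x ∈ cell d, (χ : E d → ℝ) x ∈ Icc (φ x + m) (ψ x - m))
    (hχu : ∀ x ∈ cell d, |(χ : E d → ℝ) x - u x| ≤ M) (hθ : θ ∈ Icc (0 : ℝ) 1)
    (hθM : θ * M ≤ r / 2)
    (hvu : ∀ x ∈ cell d, |(v : E d → ℝ) x - u x| ≤ min (θ * m) (r / 2)) :
    (1 - θ) • v + θ • χ ∈ competitors φ ψ u r := by
  intro x hx
  obtain ⟨hvm, hvr⟩ := le_min_iff.1 (hvu x hx)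
  refine ⟨one_sub_mul_add_mul_mem_Icc (hu x hx) (hχ x hx) hθ hvm, ?_⟩
  calc |(1 - θ) * (v : E d → ℝ) x + θ * (χ : E d → ℝ) x - u x|
      ≤ |(v : E d → ℝ) x - u x| + θ * |(χ : E d → ℝ) x - u x| :=
        abs_one_sub_mul_add_mul_sub_le hθ
    _ ≤ r / 2 + θ * M := by gcongr; exacts [hθ.1, hχu x hx]
    _ ≤ r := by linarith

lemma one_sub_smul_add_smul_mem_closure [l.NeBot] (hv : ∀ᶠ i in l, IsC1Torus (v i))
    (hvu : TendstoUniformlyOn v u l (cell d))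
    (hG : WeakStarTendsto (fun i => gradient (v i)) l G) (hG₂ : MemLp G 2 (torusMeasure d))
    (hu : ∀ x ∈ cell d, u x ∈ Icc (φ x) (ψ x)) (hm : 0 < m)
    (hχ : ∀ x ∈ cell d, (χ : E d → ℝ) x ∈ Icc (φ x + m) (ψ x - m))
    (hχu : ∀ x ∈ cell d, |(χ : E d → ℝ) x - u x| ≤ M) (hr : 0 < r) (hθ : θ ∈ Ioc (0 : ℝ) 1)
    (hθM : θ * M ≤ r / 2) :
    (1 - θ) • hG₂.toLp G + θ • gradientL2 d χ ∈
      closure (gradientL2 d '' competitors φ ψ u r) := by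
  refine mem_closure_of_forall_dual_mem_closure_image
    ((convex_competitors φ ψ u r).linear_image (gradientL2 d)) fun f => ?_
  obtain ⟨y, rfl⟩ := (InnerProductSpace.toDual ℝ (Lp (E d) 2 (torusMeasure d))).surjective f
  have hy : Integrable y (torusMeasure d) := (Lp.memLp y).integrable one_le_two
  have hlim : Tendsto (fun i => (1 - θ) * ∫ x, inner ℝ (gradient (v i) x) (y x) ∂(torusMeasure d) +
      θ * inner ℝ y (gradientL2 d χ)) l
      (𝓝 (inner ℝ y ((1 - θ) • hG₂.toLp G + θ • gradientL2 d χ))) := by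
    rw [inner_add_right, real_inner_smul_right, real_inner_smul_right, inner_toLp_eq_integral]
    exact ((hG.tendsto_pairing y hy).const_mul _).add_const _
  have hτ : 0 < min (θ * m) (r / 2) := lt_min (mul_pos hθ.1 hm) (half_pos hr)
  refine mem_closure_of_tendsto hlim ?_
  filter_upwards [hv, Metric.tendstoUniformlyOn_iff.1 hvu _ hτ] with i hi hiu
  refine ⟨_, mem_image_of_mem _ (one_sub_smul_add_smul_mem_competitors (v := ⟨v i, hi⟩) hu hχ hχu
    (Ioc_subset_Icc_self hθ) hθM fun x hx => ?_), ?_⟩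
  · rw [← Real.dist_eq, dist_comm]
    exact (hiu x hx).le
  · rw [InnerProductSpace.toDual_apply_apply, map_add, map_smul, map_smul, inner_add_right,
      real_inner_smul_right, real_inner_smul_right]
    congr 2
    exact inner_toLp_eq_integral y (memLp_gradient _)

theorem toLp_mem_closure_gradientL2_image_competitors [l.NeBot]
    (hv : ∀ᶠ i in l, IsC1Torus (v i)) (hvu : TendstoUniformlyOn v u l (cell d))
    (hG : WeakStarTendsto (fun i => gradient (v i)) l G) (hG₂ : MemLp G 2 (torusMeasure d))
    (hu : ∀ x ∈ cell d, u x ∈ Icc (φ x) (ψ x)) (hm : 0 < m)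
    (hχ : ∀ x ∈ cell d, (χ : E d → ℝ) x ∈ Icc (φ x + m) (ψ x - m)) (hr : 0 < r) :
    hG₂.toLp G ∈ closure (gradientL2 d '' competitors φ ψ u r) := by
  obtain ⟨M, hχu⟩ : ∃ M, ∀ x ∈ cell d, |(χ : E d → ℝ) x - u x| ≤ M := by
    obtain ⟨i, hi, hiu⟩ := (hv.and (Metric.tendstoUniformlyOn_iff.1 hvu 1 one_pos)).exists
    obtain ⟨M, hM⟩ := exists_norm_le_on_cell ((IsC1Torus.continuous χ.2).sub hi.continuous)
    refine ⟨M + 1, fun x hx => (abs_sub_le _ (v i x) _).trans (add_le_add (hM x hx) ?_)⟩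
    rw [← Real.dist_eq, dist_comm]
    exact (hiu x hx).le
  have hcombo : Continuous fun θ : ℝ => (1 - θ) • hG₂.toLp G + θ • gradientL2 d χ := by fun_prop
  have hlim : Tendsto (fun θ : ℝ => (1 - θ) • hG₂.toLp G + θ • gradientL2 d χ) (𝓝[>] 0)
      (𝓝 (hG₂.toLp G)) := by
    simpa using (hcombo.tendsto 0).mono_left nhdsWithin_le_nhds
  have hsmall : ∀ᶠ θ in 𝓝[>] (0 : ℝ), θ * M < r / 2 :=
    nhdsWithin_le_nhds ((continuous_mul_const M).continuousAt.eventually_lt continuousAt_const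
      (by simpa using half_pos hr))
  refine isClosed_closure.mem_of_tendsto hlim ?_
  filter_upwards [Ioc_mem_nhdsGT one_pos, hsmall] with θ hθ hθM
  exact one_sub_smul_add_smul_mem_closure hv hvu hG hG₂ hu hm hχ hχu hr hθ hθM.le

lemma exists_mem_competitors_integral_norm_gradient_lt [l.NeBot] {δ : ℝ}
    (hv : ∀ᶠ i in l, IsC1Torus (v i)) (hvu : TendstoUniformlyOn v u l (cell d))
    (hG : WeakStarTendsto (fun i => gradient (v i)) l G)
    (hu : ∀ x ∈ cell d, u x ∈ Icc (φ x) (ψ x)) (hm : 0 < m)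
    (hχ : ∀ x ∈ cell d, (χ : E d → ℝ) x ∈ Icc (φ x + m) (ψ x - m)) (hr : 0 < r) (hδ : 0 < δ) :
    ∃ w ∈ competitors φ ψ u r, ∫ x, ‖gradient (w : E d → ℝ) x‖ ∂(torusMeasure d) <
      ∫ x, ‖G x‖ ∂(torusMeasure d) + δ := by
  have hG₂ : MemLp G 2 (torusMeasure d) := hG.memLp_limit.mono_exponent le_top
  have hclosure := toLp_mem_closure_gradientL2_image_competitors hv hvu hG hG₂ hu hm hχ hr
  have hnorm : ∫ x, ‖hG₂.toLp G x‖ ∂(torusMeasure d) = ∫ x, ‖G x‖ ∂(torusMeasure d) :=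
    integral_congr_ae (hG₂.coeFn_toLp.fun_comp norm)
  have hopen : IsOpen {g : Lp (E d) 2 (torusMeasure d) |
      ∫ x, ‖g x‖ ∂(torusMeasure d) < ∫ x, ‖G x‖ ∂(torusMeasure d) + δ} :=
    isOpen_Iio.preimage continuous_integral_norm_Lp
  obtain ⟨_, hlt, w, hw, rfl⟩ := mem_closure_iff.1 hclosure _ hopen
    (hnorm.trans_lt (lt_add_of_pos_right _ hδ))
  refine ⟨w, hw, lt_of_eq_of_lt (integral_congr_ae ?_) hlt⟩
  exact ((coeFn_gradientL2 w).fun_comp norm).symm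

end Competitors

section Convergence

variable {d : ℕ} {ι : Type*} {l : Filter ι} {φ ψ u : E d → ℝ} {χ : c1Torus d} {ε : ι → ℝ}
  {v f h : ι → E d → ℝ} {G : E d → E d} {m : ℝ}

lemma eventually_integral_norm_gradient_le {C δ : ℝ} (hε : Tendsto ε l (𝓝[>] 0)) (hm : 0 < m)
    (hχ : ∀ x ∈ cell d, (χ : E d → ℝ) x ∈ Icc (φ x + m) (ψ x - m))
    (hv : ∀ᶠ i in l, IsC1Torus (v i)) (hh : ∀ᶠ i in l, HasWeakDiv (normal (ε i) (v i)) (h i))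
    (hf : ∀ᶠ i in l, IsRestoringForce φ ψ (v i) (f i))
    (hvu : TendstoUniformlyOn v u l (cell d)) (hu : ∀ x ∈ cell d, u x ∈ Icc (φ x) (ψ x))
    (hG : WeakStarTendsto (fun i => gradient (v i)) l G)
    (hC : ∀ᶠ i in l, ∫ x, |-(h i x) + f i x| ∂(torusMeasure d) ≤ C) (hδ : 0 < δ) :
    ∀ᶠ i in l, ∫ x, ‖gradient (v i) x‖ ∂(torusMeasure d) ≤
      ∫ x, ‖G x‖ ∂(torusMeasure d) + δ := by
  rcases l.eq_or_neBot with rfl | hl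
  · exact eventually_bot
  obtain ⟨r, hr, hCr⟩ : ∃ r > 0, C * (2 * r) < δ / 3 := by
    simpa only [mul_assoc] using exists_pos_mul_lt (show 0 < δ / 3 by positivity) (C * 2)
  obtain ⟨w, hw, hwG⟩ := exists_mem_competitors_integral_norm_gradient_lt hv hvu hG hu hm hχ hr
    (show 0 < δ / 3 by positivity)
  have hεδ : ∀ᶠ i in l, ε i * (torusMeasure d).real univ < δ / 3 :=
    ((tendsto_nhds_of_tendsto_nhdsWithin hε).mul_const _).eventually_lt_const (by simpa)
  filter_upwards [hv, hh, hf, hC, hεδ, hε self_mem_nhdsWithin,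
    Metric.tendstoUniformlyOn_iff.1 hvu r hr] with i hvi hhi hfi hCi hεδi hεi hui
  have hwv : ∀ x ∈ cell d, |(w : E d → ℝ) x - v i x| ≤ 2 * r := fun x hx =>
    (dist_triangle _ (u x) _).trans (by linarith [Metric.mem_closedBall.1 (hw x hx).2, hui x hx])
  have hcomp := integral_norm_gradient_le hεi hvi w.2 hhi hfi (fun x hx => (hw x hx).1) hwv
  have hCri : (∫ x, |-(h i x) + f i x| ∂(torusMeasure d)) * (2 * r) ≤ C * (2 * r) := by gcongr
  linarith

end Convergence

end ObstacleMCF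

open ObstacleMCF in
theorem mainTheorem4_general {d : ℕ} {ι : Type*} {l : Filter ι} {φ ψ u : E d → ℝ} {χ : c1Torus d}
    {ε : ι → ℝ} {v f h : ι → E d → ℝ} {G : E d → E d} {m C C' : ℝ} (hε : Tendsto ε l (𝓝[>] 0))
    (hm : 0 < m) (hχ : ∀ x ∈ cell d, (χ : E d → ℝ) x ∈ Icc (φ x + m) (ψ x - m))
    (hv : ∀ᶠ i in l, IsC1Torus (v i)) (hh : ∀ᶠ i in l, HasWeakDiv (normal (ε i) (v i)) (h i))
    (hf : ∀ᶠ i in l, IsRestoringForce φ ψ (v i) (f i))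
    (hgrad : ∀ᶠ i in l, ∀ᵐ x ∂(torusMeasure d), ‖gradient (v i) x‖ ≤ C)
    (hvu : TendstoUniformlyOn v u l (cell d)) (hu : ∀ x ∈ cell d, u x ∈ Icc (φ x) (ψ x))
    (hG : WeakStarTendsto (fun i => gradient (v i)) l G)
    (hforce : ∀ᶠ i in l, ∫ x, |-(h i x) + f i x| ∂(torusMeasure d) ≤ C') :
    WeakStarTendsto (fun i x => ‖gradient (v i) x‖) l (fun x => ‖G x‖) :=
  hG.norm_of_integral_norm_le hgrad fun _ hδ =>
    eventually_integral_norm_gradient_le hε hm hχ hv hh hf hvu hu hG hforce hδ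

theorem mainTheorem4 {d : ℕ}
    -- the obstacles
    (φ ψ : ObstacleMCF.E d → ℝ)
    (hφ : ObstacleMCF.IsC1Torus φ) (hψ : ObstacleMCF.IsC1Torus ψ) (hφψ : ∀ x, φ x < ψ x)
    -- the family `u_ε ∈ C¹`, the limit `u ∈ W^{1,∞}` with weak gradient `Du`
    (uε : ℝ → ObstacleMCF.E d → ℝ)
    (huε : ∀ ε ∈ Ioo (0 : ℝ) 1, ObstacleMCF.IsC1Torus (uε ε))
    (u : ObstacleMCF.E d → ℝ) (Du : ObstacleMCF.E d → ObstacleMCF.E d)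
    (hu : ObstacleMCF.IsW1Infty u Du)
    -- `H_ε = div ν_ε` in the weak sense
    (H : ℝ → ObstacleMCF.E d → ℝ)
    (hH : ∀ ε ∈ Ioo (0 : ℝ) 1, ObstacleMCF.HasWeakDiv (ObstacleMCF.normal ε (uε ε)) (H ε))
    (hA1 : ∃ C : ℝ, ∀ ε ∈ Ioo (0 : ℝ) 1, ∀ x, |uε ε x| ≤ C ∧ ‖gradient (uε ε) x‖ ≤ C)
    (hA2 : TendstoUniformly uε u (𝓝[>] 0))
    (hA2' : ∀ x, φ x ≤ u x ∧ u x ≤ ψ x)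
    (hA3 : ObstacleMCF.WeakStarTendsto (fun ε => gradient (uε ε)) (𝓝[>] (0 : ℝ)) Du)
    (hA4 : ∃ C : ℝ, ∀ ε ∈ Ioo (0 : ℝ) 1,
      ∫ x, |-(H ε x) + ObstacleMCF.forcing ε φ ψ (uε ε) x| ∂(ObstacleMCF.torusMeasure d) ≤ C) :
    ObstacleMCF.WeakStarTendsto (fun ε x => ‖gradient (uε ε) x‖) (𝓝[>] (0 : ℝ))
      (fun x => ‖Du x‖) := by
  obtain ⟨C, hC⟩ := hA1
  obtain ⟨C', hC'⟩ := hA4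
  obtain ⟨χ, m, hm, hχ⟩ := ObstacleMCF.exists_c1Torus_mem_Icc_of_lt hφ hψ hφψ
  have hIoo : ∀ᶠ ε in 𝓝[>] (0 : ℝ), ε ∈ Ioo (0 : ℝ) 1 := Ioo_mem_nhdsGT one_pos
  exact mainTheorem4_general tendsto_id hm hχ (hIoo.mono huε) (hIoo.mono hH)
    (hIoo.mono fun ε hε => ObstacleMCF.isRestoringForce_forcing hε.1.le hφ.continuous
      hψ.continuous (huε ε hε).continuous)
    (hIoo.mono fun ε hε => Eventually.of_forall fun x => (hC ε hε x).2)
    hA2.tendstoUniformlyOn (fun x _ => hA2' x) hA3 (hIoo.mono hC')
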